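/- A sequence $s_0s_1\cdots s_{M-1}$ with entries in $[k]=\{1,\dots,k\}$ and $M\ge m\ge 1$ is called $m$-distinguishable if the multisets $\{s_t,s_{t+1},\dots,s_{t+m-1}\}$, $0\le t\le M-m$, are pairwise distinct; it is called cyclic $m$-distinguishable if the multisets $\{s_t,s_{t+1},\dots,s_{t+m-1}\}$, $t\in\mathbb{Z}_M$, with indices taken modulo $M$, are pairwise distinct. Let $M_m(k)$ (respectively $M^c_m(k)$) denote the maximum length $M$ of an $m$-distinguishable (respectively cyclic $m$-distinguishable) sequence with entries in $[k]$. Then the maxima below exist, and the following hold. For every even integer $k\ge 4$, $$M^c_2(k)=\binom{k+1}{2}-\frac{k}{2},$$ and for every even integer $k\ge 2$, $$M_2(k)\ge\binom{k+1}{2}-\frac{k}{2}+1.$$ For every positive integer $k$ divisible by $3$, $$M^c_3(k)=\binom{k+2}{3}-\frac{k}{3}\quad\text{and}\quad M_3(k)\ge\binom{k+2}{3}-\frac{k}{3}+2.$$ -/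

import Mathlib

/-- The multiset of colors `{s_t, s_{t+1}, …, s_{t+m-1}}` of the `m`-block tagged at `t` of the
(linear) sequence `s_0 s_1 ⋯ s_{M-1}` on the `k` colors `Fin k`. -/
def blockMultiset {M k : ℕ} (m : ℕ) (s : Fin M → Fin k) (t : ℕ) (ht : t + m ≤ M) :
    Multiset (Fin k) :=
  (Finset.univ : Finset (Fin m)).val.map
    (fun i => s ⟨t + i.val, lt_of_lt_of_le (Nat.add_lt_add_left i.isLt t) ht⟩)

/-- A sequence `s_0 s_1 ⋯ s_{M-1}` is `m`-distinguishable if the multisets tagged at the points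
`0 ≤ t ≤ M - m` are all distinct. -/
def IsDistinguishable {M k : ℕ} (m : ℕ) (s : Fin M → Fin k) : Prop :=
  ∀ (t u : ℕ) (ht : t + m ≤ M) (hu : u + m ≤ M),
    blockMultiset m s t ht = blockMultiset m s u hu → t = u

/-- The multiset of colors `{s_t, s_{t+1}, …, s_{t+m-1}}`, indices modulo `M`, of the `m`-block
tagged at `t` of a cyclic sequence of length `M` on the `k` colors `Fin k`. -/
def cyclicBlockMultiset {M k : ℕ} (m : ℕ) (s : ZMod M → Fin k) (t : ZMod M) :
    Multiset (Fin k) :=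
  (Finset.univ : Finset (Fin m)).val.map (fun i => s (t + (i.val : ZMod M)))

/-- A cyclic sequence of length `M` is cyclic `m`-distinguishable if the multisets tagged at all
`t` in `ZMod M` are distinct. -/
def IsCyclicDistinguishable {M k : ℕ} (m : ℕ) (s : ZMod M → Fin k) : Prop :=
  Function.Injective (cyclicBlockMultiset m s)

/-- The lengths `M` (positive, with `m ≤ M`) of `m`-distinguishable sequences on `k` colors. -/
def distinguishableLengths (m k : ℕ) : Set ℕ :=
  {M | 0 < M ∧ m ≤ M ∧ ∃ s : Fin M → Fin k, IsDistinguishable m s}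

/-- The lengths `M` (positive, with `m ≤ M`) of cyclic `m`-distinguishable sequences on `k`
colors. -/
def cyclicDistinguishableLengths (m k : ℕ) : Set ℕ :=
  {M | 0 < M ∧ m ≤ M ∧ ∃ s : ZMod M → Fin k, IsCyclicDistinguishable m s}

/-- `M_m(k)`: the maximum length of an `m`-distinguishable sequence on `k` colors. (A supremum in
`ℕ` is `0` for an empty or unbounded set, and otherwise it is attained.) -/
noncomputable def maxLength (m k : ℕ) : ℕ :=
  sSup (distinguishableLengths m k)

/-- `M^c_m(k)`: the maximum length of a cyclic `m`-distinguishable sequence on `k` colors. (A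
supremum in `ℕ` is `0` for an empty or unbounded set, and otherwise it is attained.) -/
noncomputable def maxCyclicLength (m k : ℕ) : ℕ :=
  sSup (cyclicDistinguishableLengths m k)

/-! Upper bound: in a cyclic sequence, every occurrence of a color `x` is counted by `m` windows, so
the windows together contain `x` a multiple of `m` times. All multisets of size `m` together contain
`x`, by symmetry between colors, `m / k` times their number; this is `k + 1` for `m = 2` and `(k +
1)(k + 2) / 2` for `m = 3`, which `m` does not divide when it divides `k`. Hence every color occurs
in an omitted multiset, and at least `k / m` multisets are omitted
(`add_le_choose_of_mem_cyclicDistinguishableLengths`).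

Lower bound: split the colors into classes of `m` consecutive letters and omit exactly the classes.
Each remaining multiset is ordered into a word, an edge from its prefix to its suffix, so that the
words form one closed trail. The trail is glued from small closed walks at common vertices
(`IsClosedTour.add`), each walk covering multisets that meet one, two or three given classes. For
triples, explicit walks are checked by `decide` and relabeled. Since the words are exactly as many
as the multisets to cover, covering all of them forces distinctness (`mem_lengths_of_isClosedTour`).
Opening the closed trail gives a linear sequence with `m - 1` more letters. -/

/-! ### Trails and closed tours of words -/

/-- Trails in the graph whose edges are words and whose vertices are their prefixes and suffixes:
`WordTrail v w E` says that the words of `E` can be arranged into a trail from `v` to `w`. -/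
inductive WordTrail {α : Type*} : List α → List α → Multiset (List α) → Prop
  | nil (v : List α) : WordTrail v v 0
  | cons (e : List α) {w : List α} {E : Multiset (List α)} (h : WordTrail e.tail w E) :
      WordTrail e.dropLast w (e ::ₘ E)

namespace WordTrail

variable {α β : Type*} {u v w : List α} {E F : Multiset (List α)}

theorem trans (h : WordTrail u v E) (h' : WordTrail v w F) : WordTrail u w (E + F) := by
  induction h with
  | nil => simpa using h'
  | cons e _ ih => rw [Multiset.cons_add]; exact cons e (ih h')

theorem exists_split (h : WordTrail v w E) {e : List α} (he : e ∈ E) :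
    ∃ E₁ E₂, E = E₁ + E₂ ∧ WordTrail v e.dropLast E₁ ∧ WordTrail e.dropLast w E₂ := by
  induction h with
  | nil => simp at he
  | @cons f w E h ih =>
    rcases Multiset.mem_cons.1 he with rfl | he
    · exact ⟨0, _, (zero_add _).symm, nil _, cons _ h⟩
    · obtain ⟨E₁, E₂, rfl, h₁, h₂⟩ := ih he
      exact ⟨f ::ₘ E₁, E₂, (Multiset.cons_add _ _ _).symm, cons f h₁, h₂⟩

theorem rotate (h : WordTrail v v E) {e : List α} (he : e ∈ E) :
    WordTrail e.dropLast e.dropLast E := by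
  obtain ⟨E₁, E₂, rfl, h₁, h₂⟩ := h.exists_split he
  rw [add_comm]
  exact h₂.trans h₁

theorem map (f : α → β) (h : WordTrail v w E) :
    WordTrail (v.map f) (w.map f) (E.map (List.map f)) := by
  induction h with
  | nil => exact nil _
  | cons e _ ih =>
    rw [Multiset.map_cons, List.map_dropLast]
    rw [List.map_tail] at ih
    exact cons _ ih

/-- The words read along a trail are the windows of a single sequence. -/
theorem exists_sequence [Inhabited α] {m : ℕ} (h : WordTrail v w E) (hE : ∀ e ∈ E, e.length = m + 1)
    (hv : v.length = m) :
    ∃ f : ℕ → α, v = (List.range m).map f ∧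
      w = (List.range m).map (fun i => f (E.card + i)) ∧
      E = (Multiset.range E.card).map
        (fun t => (List.range (m + 1)).map (fun i => f (t + i))) := by
  induction h with
  | nil v =>
    -- Only indices below `m` are read here, so the default letter never matters.
    refine ⟨fun i => v.getD i default, ?_, ?_, by simp⟩ <;>
    · apply List.ext_getElem
      · simp [hv]
      · intro i h₁ h₂
        simp [h₁]
  | @cons e w E h ih =>
    have hel : e.length = m + 1 := hE e (by simp)
    obtain ⟨f, h₁, h₂, h₃⟩ := ih (fun e' he' => hE e' (by simp [he'])) (by simp [hel])
    obtain ⟨a, l, rfl⟩ : ∃ a l, e = a :: l := by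
      cases e with
      | nil => simp at hel
      | cons a l => exact ⟨a, l, rfl⟩
    rw [List.tail_cons] at h₁
    -- The new word contributes one letter, placed in front of the sequence `f` of the remaining
    -- trail.
    let g : ℕ → α := fun n => Nat.casesOn n a f
    have hg : ∀ n, g (n + 1) = f n := fun n => rfl
    have hal : a :: l = (List.range (m + 1)).map g := by
      rw [List.range_succ_eq_map, List.map_cons, List.map_map, h₁]
      rfl
    refine ⟨g, ?_, ?_, ?_⟩
    · rw [hal, List.range_succ, List.map_append]
      simp
    · rw [h₂, Multiset.card_cons]
      refine List.map_congr_left fun i _ => ?_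
      rw [add_right_comm, hg]
    · have hr : Multiset.range (E.card + 1) = 0 ::ₘ (Multiset.range E.card).map Nat.succ := by
        rw [← Multiset.coe_range, List.range_succ_eq_map]
        rfl
      rw [Multiset.card_cons, hr, Multiset.map_cons, Multiset.map_map]
      simp only [zero_add]
      rw [← hal]
      congr 1
      conv_lhs => rw [h₃]
      refine Multiset.map_congr rfl fun t _ => List.map_congr_left fun i _ => ?_
      show f (t + i) = g (t + 1 + i)
      rw [add_right_comm, hg]

end WordTrail

/-- The words of `E` can be arranged into a closed trail, which may start at any of them. -/
def IsClosedTour {α : Type*} (E : Multiset (List α)) : Prop :=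
  ∀ e ∈ E, WordTrail e.dropLast e.dropLast E

namespace IsClosedTour

variable {α : Type*} {E F : Multiset (List α)}

theorem of_trail {v : List α} (h : WordTrail v v E) : IsClosedTour E := fun _ he => h.rotate he

theorem zero : IsClosedTour (0 : Multiset (List α)) := fun _ he => by simp at he

theorem map {β : Type*} (f : α → β) (h : IsClosedTour E) : IsClosedTour (E.map (List.map f)) := by
  intro e he
  obtain ⟨e', he', rfl⟩ := Multiset.mem_map.1 he
  have := (h e' he').map f
  rwa [List.map_dropLast] at this

/-- Both tours can be started at the common vertex, then run one after the other. -/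
theorem add (hE : IsClosedTour E) (hF : IsClosedTour F) {e f : List α} (he : e ∈ E) (hf : f ∈ F)
    (hef : e.dropLast = f.dropLast) : IsClosedTour (E + F) := by
  have h := hF f hf
  rw [← hef] at h
  exact of_trail ((hE e he).trans h)

theorem add_sum {ι : Type*} (hE : IsClosedTour E) (s : Finset ι) (F : ι → Multiset (List α))
    (hF : ∀ i ∈ s, IsClosedTour (F i))
    (h : ∀ i ∈ s, ∃ e ∈ E, ∃ f ∈ F i, e.dropLast = f.dropLast) :
    IsClosedTour (E + ∑ i ∈ s, F i) := by
  classical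
  induction s using Finset.induction_on with
  | empty => simpa using hE
  | insert i s hi ih =>
    rw [Finset.sum_insert hi, add_comm (F i), ← add_assoc]
    obtain ⟨e, he, f, hf, hef⟩ := h i (by simp)
    exact (ih (fun j hj => hF j (by simp [hj])) (fun j hj => h j (by simp [hj]))).add
      (hF i (by simp)) (Multiset.mem_add.2 (Or.inl he)) hf hef

end IsClosedTour

/-- The words met when the letters of `l` are appended one by one to the word `v`, where the first
letter is dropped each time. -/
def wordWalk {α : Type*} : List α → List α → List (List α)
  | _, [] => []
  | v, c :: l => (v ++ [c]) :: wordWalk (v ++ [c]).tail l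

/-- The last vertex of `wordWalk v l`. -/
def wordWalkEnd {α : Type*} : List α → List α → List α
  | v, [] => v
  | v, c :: l => wordWalkEnd (v ++ [c]).tail l

theorem wordTrail_wordWalk {α : Type*} (v l : List α) :
    WordTrail v (wordWalkEnd v l) (wordWalk v l : Multiset (List α)) := by
  induction l generalizing v with
  | nil => exact WordTrail.nil v
  | cons c l ih =>
    have := WordTrail.cons (v ++ [c]) (ih _)
    rwa [List.dropLast_concat] at this

theorem isClosedTour_wordWalk {α : Type*} {v l : List α} (h : wordWalkEnd v l = v) :
    IsClosedTour (wordWalk v l : Multiset (List α)) := by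
  have := wordTrail_wordWalk v l
  rw [h] at this
  exact IsClosedTour.of_trail this

theorem length_of_mem_wordWalk {α : Type*} {v l e : List α} (he : e ∈ wordWalk v l) :
    e.length = v.length + 1 := by
  induction l generalizing v with
  | nil => simp [wordWalk] at he
  | cons c l ih =>
    rcases List.mem_cons.1 he with rfl | he
    · simp
    · simpa using ih he

theorem length_wordWalk {α : Type*} (v l : List α) : (wordWalk v l).length = l.length := by
  induction l generalizing v with
  | nil => rfl
  | cons c l ih => simp [wordWalk, ih]

/-! ### Counting multiplicities: the upper bound and existence of maxima -/

/-- Total multiplicity of the color `x` in all multisets of size `m`. -/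
def totalMultiplicity (m k : ℕ) (x : Fin k) : ℕ :=
  ∑ σ : Sym (Fin k) m, (σ : Multiset (Fin k)).count x

theorem sum_count_sym {m k : ℕ} (σ : Sym (Fin k) m) :
    ∑ x, (σ : Multiset (Fin k)).count x = m := by
  rw [Multiset.sum_count_eq_card (fun _ _ => Finset.mem_univ _)]
  exact σ.2

theorem totalMultiplicity_eq (m k : ℕ) (x y : Fin k) :
    totalMultiplicity m k x = totalMultiplicity m k y := by
  unfold totalMultiplicity
  refine Fintype.sum_equiv (Sym.equivCongr (Equiv.swap x y)) _ _ fun σ => ?_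
  rw [Sym.equivCongr_apply, Sym.coe_map]
  have h := Multiset.count_map_eq_count' (Equiv.swap x y) (σ : Multiset (Fin k))
    (Equiv.swap x y).injective x
  rw [Equiv.swap_apply_left] at h
  exact h.symm

/-- Double counting: the `k` colors have equal totals, and each multiset contributes `m` to their
sum. -/
theorem mul_totalMultiplicity (m k : ℕ) (x : Fin k) :
    k * totalMultiplicity m k x = m * (k + m - 1).choose m := by
  have h : ∑ y : Fin k, totalMultiplicity m k y = m * (k + m - 1).choose m := by
    unfold totalMultiplicity
    rw [Finset.sum_comm]
    simp only [sum_count_sym, Finset.sum_const, smul_eq_mul, Finset.card_univ,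
      Sym.card_sym_eq_choose, Fintype.card_fin]
    rw [mul_comm]
  rw [← h, Finset.sum_congr rfl fun y _ => totalMultiplicity_eq m k y x]
  simp

theorem card_blockMultiset {M k m : ℕ} (s : Fin M → Fin k) (t : ℕ) (ht : t + m ≤ M) :
    (blockMultiset m s t ht).card = m := by
  simp [blockMultiset]

theorem card_cyclicBlockMultiset {M k m : ℕ} (s : ZMod M → Fin k) (t : ZMod M) :
    (cyclicBlockMultiset m s t).card = m := by
  simp [cyclicBlockMultiset]

/-- For each of the `m` offsets, translation permutes `ZMod M`, so every offset sees all occurrences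
of `x` once. -/
theorem sum_count_cyclicBlockMultiset {M k m : ℕ} [NeZero M] (s : ZMod M → Fin k) (x : Fin k) :
    ∑ t, (cyclicBlockMultiset m s t).count x = m * ∑ t, if s t = x then 1 else 0 := by
  have h : ∀ t, (cyclicBlockMultiset m s t).count x =
      ∑ i : Fin m, if s (t + (i.val : ZMod M)) = x then 1 else 0 := by
    intro t
    rw [cyclicBlockMultiset, Multiset.count_map, ← Finset.filter_val, Finset.card_val,
      Finset.card_filter]
    simp only [eq_comm]
  simp only [h]
  rw [Finset.sum_comm]
  have h' : ∀ i : Fin m, (∑ t, if s (t + (i.val : ZMod M)) = x then 1 else 0) =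
      ∑ t, if s t = x then 1 else 0 := fun i =>
    Fintype.sum_equiv (Equiv.addRight (i.val : ZMod M)) _ _ fun t => rfl
  simp [h']

theorem add_le_choose_of_mem_cyclicDistinguishableLengths {m k M : ℕ}
    (hk : ∀ x : Fin k, ¬ m ∣ totalMultiplicity m k x)
    (hM : M ∈ cyclicDistinguishableLengths m k) : M + k / m ≤ (k + m - 1).choose m := by
  classical
  obtain ⟨hpos, -, s, hs⟩ := hM
  have : NeZero M := ⟨hpos.ne'⟩
  let W : ZMod M → Sym (Fin k) m := fun t =>
    ⟨cyclicBlockMultiset m s t, card_cyclicBlockMultiset s t⟩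
  have hW : Function.Injective W := fun t u h => hs (congrArg Subtype.val h)
  set A := Finset.univ.image W with hA
  have hAcard : A.card = M := by
    rw [hA, Finset.card_image_of_injective _ hW, Finset.card_univ, ZMod.card]
  have hcard : A.card + Aᶜ.card = (k + m - 1).choose m := by
    rw [Finset.card_add_card_compl, Sym.card_sym_eq_choose, Fintype.card_fin]
  -- A color absent from all omitted multisets would have its whole total multiplicity inside the
  -- windows, hence divisible by `m`.
  have hpos' : ∀ x : Fin k, 1 ≤ ∑ σ ∈ Aᶜ, (σ : Multiset (Fin k)).count x := by
    intro x
    by_contra hx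
    have hx : ∑ σ ∈ Aᶜ, (σ : Multiset (Fin k)).count x = 0 := by omega
    apply hk x
    rw [totalMultiplicity, ← Finset.sum_add_sum_compl A, hx, add_zero, hA,
      Finset.sum_image hW.injOn]
    exact ⟨_, sum_count_cyclicBlockMultiset s x⟩
  have hsum : k ≤ Aᶜ.card * m := by
    calc k = ∑ x : Fin k, 1 := by simp
      _ ≤ ∑ x : Fin k, ∑ σ ∈ Aᶜ, (σ : Multiset (Fin k)).count x :=
        Finset.sum_le_sum fun x _ => hpos' x
      _ = Aᶜ.card * m := by
        rw [Finset.sum_comm]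
        simp only [sum_count_sym, Finset.sum_const, smul_eq_mul]
  have := Nat.div_le_of_le_mul (by rwa [mul_comm] at hsum : k ≤ m * Aᶜ.card)
  omega

theorem isGreatest_sSup_nat {S : Set ℕ} (hne : S.Nonempty) {b : ℕ} (hb : ∀ n ∈ S, n ≤ b) :
    IsGreatest S (sSup S) :=
  ⟨Nat.sSup_mem hne ⟨b, hb⟩, fun _ hn => le_csSup ⟨b, hb⟩ hn⟩

theorem le_of_mem_distinguishableLengths {m k M : ℕ} (hM : M ∈ distinguishableLengths m k) :
    M ≤ (k + m - 1).choose m + m := by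
  classical
  obtain ⟨hpos, hmM, s, hs⟩ := hM
  -- The last window is left out: any finite bound suffices for the supremum to be attained.
  let W : Fin (M - m) → Sym (Fin k) m := fun t =>
    ⟨blockMultiset m s t.val (by omega), card_blockMultiset s _ _⟩
  have hW : Function.Injective W := fun t u h => 
    Fin.ext (hs t u (by omega) (by omega) (congrArg Subtype.val h))
  have := Fintype.card_le_of_injective W hW
  rw [Sym.card_sym_eq_choose, Fintype.card_fin, Fintype.card_fin] at this
  omega

/-! ### From closed tours to distinguishable sequences -/

section Sequences

variable {m k : ℕ} {E : Multiset (List (Fin k))}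

theorem map_univ_fin_eq_range {α : Type*} (m : ℕ) (g : ℕ → α) :
    (Finset.univ : Finset (Fin m)).val.map (fun i => g i.val) = ((List.range m).map g : List α) := by
  rw [Fin.univ_val_map]
  congr 1
  apply List.ext_getElem <;> simp

theorem mem_distinguishableLengths_of_trail [NeZero k] {v w : List (Fin k)}
    (h : WordTrail v w E) (hE : ∀ e ∈ E, e.length = m + 1) (hv : v.length = m)
    (hpos : 0 < E.card) (hnd : (E.map Multiset.ofList).Nodup) :
    E.card + m ∈ distinguishableLengths (m + 1) k := by
  obtain ⟨f, -, -, hf⟩ := h.exists_sequence hE hv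
  rw [hf, Multiset.map_map] at hnd
  refine ⟨by omega, by omega, fun i => f i.val, fun t u ht hu htu => ?_⟩
  refine Multiset.inj_on_of_nodup_map hnd t (Multiset.mem_range.2 (by omega)) u
    (Multiset.mem_range.2 (by omega)) ?_
  simpa only [Function.comp_apply, blockMultiset, map_univ_fin_eq_range (m + 1) (fun i => f (t + i)),
    map_univ_fin_eq_range (m + 1) (fun i => f (u + i))] using htu

theorem mem_cyclicDistinguishableLengths_of_trail [NeZero k] {v : List (Fin k)}
    (h : WordTrail v v E) (hE : ∀ e ∈ E, e.length = m + 1) (hv : v.length = m)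
    (hcard : m + 1 ≤ E.card) (hnd : (E.map Multiset.ofList).Nodup) :
    E.card ∈ cyclicDistinguishableLengths (m + 1) k := by
  obtain ⟨f, hf₀, hf₁, hf⟩ := h.exists_sequence hE hv
  rw [hf, Multiset.map_map] at hnd
  have : NeZero E.card := ⟨by omega⟩
  -- The trail is closed, so the `m` letters after one period repeat the first `m`; a window that
  -- wraps around needs no more.
  have hper : ∀ i < m, f (E.card + i) = f i := by
    have := hf₁.symm.trans hf₀
    intro i hi
    exact List.map_inj_left.1 this i (List.mem_range.2 hi)
  have hblock : ∀ t : ZMod E.card, cyclicBlockMultiset (m + 1) (fun t => f t.val) t =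
      ((List.range (m + 1)).map (fun i => f (t.val + i)) : List (Fin k)) := by
    intro t
    rw [← map_univ_fin_eq_range]
    refine Multiset.map_congr rfl fun i _ => ?_
    have ht := ZMod.val_lt t
    have hi := i.isLt
    have hval : (t + (i.val : ZMod E.card)).val = (t.val + i.val) % E.card := by
      rw [ZMod.val_add, ZMod.val_natCast, Nat.add_mod_mod]
    change f (t + (i.val : ZMod E.card)).val = _
    rw [hval]
    rcases lt_or_ge (t.val + i.val) E.card with hlt | hge
    · rw [Nat.mod_eq_of_lt hlt]
    · obtain ⟨j, hj⟩ := Nat.exists_eq_add_of_le hge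
      rw [hj, Nat.add_mod_left, Nat.mod_eq_of_lt (by omega), hper j (by omega)]
  refine ⟨by omega, hcard, fun t => f t.val, fun t u htu => ZMod.val_injective _ ?_⟩
  rw [hblock, hblock] at htu
  exact Multiset.inj_on_of_nodup_map hnd t.val (Multiset.mem_range.2 (ZMod.val_lt t)) u.val
    (Multiset.mem_range.2 (ZMod.val_lt u)) htu

/-- A closed tour of words that covers all multisets of size `m + 1` but those of `B`, and has no
more words than there are such multisets, solves the problem. -/
theorem mem_lengths_of_isClosedTour [NeZero k] (h : IsClosedTour E)
    (hE : ∀ e ∈ E, e.length = m + 1) (hcard : m + 1 ≤ E.card)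
    (B : Finset (Multiset (Fin k)))
    (hB : E.card + B.card ≤ (k + m).choose (m + 1))
    (hcov : ∀ σ : Multiset (Fin k), σ.card = m + 1 → σ ∉ B → ∃ e ∈ E, (e : Multiset (Fin k)) = σ) :
    E.card ∈ cyclicDistinguishableLengths (m + 1) k ∧
      E.card + m ∈ distinguishableLengths (m + 1) k := by
  classical
  have hnd : (E.map Multiset.ofList).Nodup := by
    rw [← Multiset.toFinset_card_eq_card_iff_nodup]
    refine le_antisymm (Multiset.toFinset_card_le _) ?_
    -- The multisets read by the tour together with `B` exhaust all multisets. By `hB` there are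
    -- then at least `E.card` distinct ones among those read, so none is repeated.
    have hsub : Finset.univ.image (fun σ : Sym (Fin k) (m + 1) => (σ : Multiset (Fin k))) ⊆
        (E.map Multiset.ofList).toFinset ∪ B := by
      intro σ hσ
      obtain ⟨σ, -, rfl⟩ := Finset.mem_image.1 hσ
      by_cases hσB : (σ : Multiset (Fin k)) ∈ B
      · exact Finset.mem_union_right _ hσB
      · obtain ⟨e, he, hes⟩ := hcov σ σ.2 hσB
        exact Finset.mem_union_left _ (Multiset.mem_toFinset.2 (Multiset.mem_map.2 ⟨e, he, hes⟩))
    have h₁ := (Finset.card_le_card hsub).trans (Finset.card_union_le _ _)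
    rw [Finset.card_image_of_injective _ Sym.coe_injective, Finset.card_univ,
      Sym.card_sym_eq_choose, Fintype.card_fin] at h₁
    rw [Multiset.card_map]
    have : k + (m + 1) - 1 = k + m := rfl
    rw [this] at h₁
    omega
  obtain ⟨e, he⟩ := Multiset.card_pos_iff_exists_mem.1 (by omega : 0 < E.card)
  have hv : e.dropLast.length = m := by simp [hE e he]
  exact ⟨mem_cyclicDistinguishableLengths_of_trail (h e he) hE hv hcard hnd,
    mem_distinguishableLengths_of_trail (h e he) hE hv (by omega) hnd⟩

end Sequences

/-- Lets the tours be written with letters in `ℕ`. Reduction modulo `k` preserves closedness,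
lengths and cardinality, and fixes the letters below `k`, so coverage survives. -/
theorem mem_lengths_of_isClosedTour_nat {m k : ℕ} [NeZero k] {E : Multiset (List ℕ)}
    (h : IsClosedTour E) (hE : ∀ e ∈ E, e.length = m + 1) (hcard : m + 1 ≤ E.card)
    (B : Finset (Multiset ℕ)) (hB : E.card + B.card ≤ (k + m).choose (m + 1))
    (hcov : ∀ σ : Multiset ℕ, σ.card = m + 1 → (∀ x ∈ σ, x < k) → σ ∉ B →
      ∃ e ∈ E, (e : Multiset ℕ) = σ) :
    E.card ∈ cyclicDistinguishableLengths (m + 1) k ∧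
      E.card + m ∈ distinguishableLengths (m + 1) k := by
  classical
  have hinv : ∀ σ : Multiset (Fin k), (σ.map Fin.val).map (Fin.ofNat k) = σ := by
    intro σ
    rw [Multiset.map_map]
    conv_rhs => rw [← Multiset.map_id σ]
    exact Multiset.map_congr rfl fun x _ => Fin.ofNat_val_eq_self x
  have key := mem_lengths_of_isClosedTour (m := m) (h.map (Fin.ofNat k)) ?_ ?_
    (B.image (Multiset.map (Fin.ofNat k))) ?_ ?_
  · rwa [Multiset.card_map] at key
  · intro e he
    obtain ⟨e', he', rfl⟩ := Multiset.mem_map.1 he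
    rw [List.length_map, hE e' he']
  · rwa [Multiset.card_map]
  · rw [Multiset.card_map]
    exact (Nat.add_le_add_left Finset.card_image_le _).trans hB
  · intro σ hσ hσB
    obtain ⟨e, he, hes⟩ := hcov (σ.map Fin.val) (by rwa [Multiset.card_map])
      (fun x hx => by
        obtain ⟨y, -, rfl⟩ := Multiset.mem_map.1 hx
        exact y.isLt)
      (fun hmem => hσB (Finset.mem_image.2 ⟨_, hmem, hinv σ⟩))
    refine ⟨_, Multiset.mem_map_of_mem _ he, ?_⟩
    rw [← Multiset.map_coe, hes, hinv]

theorem two_mul_choose_add_one (k : ℕ) : 2 * (k + 1).choose 2 = k * (k + 1) := by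
  have h := Nat.add_one_mul_choose_eq k 1
  simp only [Nat.choose_one_right, Nat.reduceAdd] at h
  linarith

theorem six_mul_choose_add_two (k : ℕ) : 6 * (k + 2).choose 3 = k * (k + 1) * (k + 2) := by
  have h := Nat.add_one_mul_choose_eq (k + 1) 2
  have h' := two_mul_choose_add_one k
  simp only [Nat.reduceAdd, add_assoc] at h
  calc 6 * (k + 2).choose 3 = 2 * ((k + 2).choose 3 * 3) := by ring
    _ = (k + 2) * (2 * (k + 1).choose 2) := by rw [← h]; ring
    _ = _ := by rw [h']; ring

/-! ### Pairs -/

/-- The four pairs between `{2i, 2i+1}` and `{2j, 2j+1}`, as a closed walk. -/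
def pairCycle (i j : ℕ) : Multiset (List ℕ) :=
  wordWalk [2 * i] [2 * j, 2 * i + 1, 2 * j + 1, 2 * i]

/-- A tour through all pairs of letters in different classes `{2i, 2i+1}`, `i < n`. -/
def pairTour (n : ℕ) : Multiset (List ℕ) :=
  ∑ j ∈ Finset.range n, ∑ i ∈ Finset.range j, pairCycle i j

/-- `pairTour` together with all loops. -/
def pairLoopTour (n : ℕ) : Multiset (List ℕ) :=
  pairTour n + ∑ a ∈ Finset.range (2 * n), (wordWalk [a] [a] : Multiset (List ℕ))

theorem mem_pairTour {n i j : ℕ} {e : List ℕ} (hij : i < j) (hj : j < n)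
    (he : e ∈ pairCycle i j) : e ∈ pairTour n :=
  Multiset.mem_sum.2 ⟨j, Finset.mem_range.2 hj, Multiset.mem_sum.2 ⟨i, Finset.mem_range.2 hij, he⟩⟩

theorem mem_pairCycle {i j : ℕ} {e : List ℕ} : e ∈ pairCycle i j ↔
    e = [2 * i, 2 * j] ∨ e = [2 * j, 2 * i + 1] ∨ e = [2 * i + 1, 2 * j + 1] ∨
      e = [2 * j + 1, 2 * i] := by
  simp [pairCycle, wordWalk]

/-- Every letter is a vertex of the tour, so loops and new cycles can be attached anywhere. A second
class is needed: class `0` is reached through class `1`, every other one through class `0`. -/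
theorem exists_mem_pairTour {n a : ℕ} (hn : 2 ≤ n) (ha : a < 2 * n) :
    ∃ e ∈ pairTour n, e.dropLast = [a] := by
  obtain ⟨j, rfl | rfl⟩ : ∃ j, a = 2 * j ∨ a = 2 * j + 1 := ⟨a / 2, by omega⟩
  · rcases Nat.eq_zero_or_pos j with rfl | hj
    · exact ⟨[2 * 0, 2 * 1], mem_pairTour zero_lt_one (by omega) (mem_pairCycle.2 (by simp)), rfl⟩
    · exact ⟨[2 * j, 2 * 0 + 1], mem_pairTour hj (by omega) (mem_pairCycle.2 (by simp)), rfl⟩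
  · rcases Nat.eq_zero_or_pos j with rfl | hj
    · exact ⟨[2 * 0 + 1, 2 * 1 + 1], mem_pairTour zero_lt_one (by omega)
        (mem_pairCycle.2 (by simp)), rfl⟩
    · exact ⟨[2 * j + 1, 2 * 0], mem_pairTour hj (by omega) (mem_pairCycle.2 (by simp)), rfl⟩

theorem isClosedTour_pairCycle (i j : ℕ) : IsClosedTour (pairCycle i j) :=
  isClosedTour_wordWalk rfl

theorem isClosedTour_pairTour {n : ℕ} (hn : 2 ≤ n) : IsClosedTour (pairTour n) := by
  induction n, hn using Nat.le_induction with
  | base => simpa [pairTour, Finset.sum_range_succ] using isClosedTour_pairCycle 0 1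
  | succ n hn ih =>
    rw [pairTour, Finset.sum_range_succ]
    refine ih.add_sum _ _ (fun i _ => isClosedTour_pairCycle i n) fun i hi => ?_
    obtain ⟨e, he, hei⟩ := exists_mem_pairTour hn (a := 2 * i) (by have := Finset.mem_range.1 hi; omega)
    exact ⟨e, he, [2 * i, 2 * n], mem_pairCycle.2 (by simp), hei⟩

theorem isClosedTour_pairLoopTour {n : ℕ} (hn : 2 ≤ n) : IsClosedTour (pairLoopTour n) := by
  refine (isClosedTour_pairTour hn).add_sum _ _ (fun a _ => isClosedTour_wordWalk rfl)
    fun a ha => ?_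
  obtain ⟨e, he, hea⟩ := exists_mem_pairTour hn (Finset.mem_range.1 ha)
  exact ⟨e, he, [a, a], by simp [wordWalk], hea⟩

theorem length_of_mem_pairLoopTour {n : ℕ} {e : List ℕ} (he : e ∈ pairLoopTour n) :
    e.length = 2 := by
  rcases Multiset.mem_add.1 he with he | he
  · obtain ⟨j, -, he⟩ := Multiset.mem_sum.1 he
    obtain ⟨i, -, he⟩ := Multiset.mem_sum.1 he
    exact length_of_mem_wordWalk he
  · obtain ⟨a, -, he⟩ := Multiset.mem_sum.1 he
    exact length_of_mem_wordWalk he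

theorem card_pairLoopTour (n : ℕ) : (pairLoopTour n).card = 2 * n ^ 2 := by
  -- The `2 * n` loops are put on the left to avoid subtraction.
  have h : ∀ n : ℕ, (pairTour n).card + 2 * n = 2 * n ^ 2 := by
    intro n
    induction n with
    | zero => simp [pairTour]
    | succ n ih =>
      rw [pairTour, Finset.sum_range_succ, Multiset.card_add, ← pairTour, Multiset.card_sum]
      simp only [pairCycle, Multiset.coe_card, length_wordWalk]
      simp only [List.length_cons, List.length_nil, Finset.sum_const, Finset.card_range,
        smul_eq_mul]
      linarith
  rw [pairLoopTour, Multiset.card_add, Multiset.card_sum, ← h n]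
  simp [wordWalk]

theorem exists_pairLoopTour_eq {n : ℕ} (σ : Multiset ℕ) (hσ : σ.card = 2)
    (hn : ∀ x ∈ σ, x < 2 * n)
    (hB : σ ∉ (Finset.range n).image fun i => ({2 * i, 2 * i + 1} : Multiset ℕ)) :
    ∃ e ∈ pairLoopTour n, (e : Multiset ℕ) = σ := by
  obtain ⟨p, q, hpq, rfl⟩ : ∃ p q, p ≤ q ∧ σ = {p, q} := by
    obtain ⟨p, q, rfl⟩ := Multiset.card_eq_two.1 hσ
    rcases le_total p q with h | h
    · exact ⟨p, q, h, rfl⟩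
    · exact ⟨q, p, h, Multiset.pair_comm p q⟩
  have hp : p < 2 * n := hn p (by simp)
  have hq : q < 2 * n := hn q (by simp)
  have hcycle : ∀ {i j : ℕ} {e : List ℕ}, i < j → j < n → e ∈ pairCycle i j →
      e ∈ pairLoopTour n :=
    fun hij hj he => Multiset.mem_add.2 (Or.inl (mem_pairTour hij hj he))
  rcases eq_or_ne p q with rfl | hne
  · exact ⟨[p, p], Multiset.mem_add.2 (Or.inr (Multiset.mem_sum.2
      ⟨p, Finset.mem_range.2 hp, by simp [wordWalk]⟩)), rfl⟩
  obtain ⟨i, hi⟩ : ∃ i, p = 2 * i ∨ p = 2 * i + 1 := ⟨p / 2, by omega⟩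
  obtain ⟨j, hj⟩ : ∃ j, q = 2 * j ∨ q = 2 * j + 1 := ⟨q / 2, by omega⟩
  have hjn : j < n := by omega
  rcases eq_or_ne i j with rfl | hij
  · refine absurd (Finset.mem_image.2 ⟨i, Finset.mem_range.2 hjn, ?_⟩) hB
    rw [show p = 2 * i by omega, show q = 2 * i + 1 by omega]
  have hij : i < j := by omega
  rcases hi with rfl | rfl <;> rcases hj with rfl | rfl
  · exact ⟨[2 * i, 2 * j], hcycle hij hjn (mem_pairCycle.2 (by simp)), rfl⟩
  · exact ⟨[2 * j + 1, 2 * i], hcycle hij hjn (mem_pairCycle.2 (by simp)),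
      Multiset.pair_comm _ _⟩
  · exact ⟨[2 * j, 2 * i + 1], hcycle hij hjn (mem_pairCycle.2 (by simp)),
      Multiset.pair_comm _ _⟩
  · exact ⟨[2 * i + 1, 2 * j + 1], hcycle hij hjn (mem_pairCycle.2 (by simp)), rfl⟩

theorem pair_lengths {n : ℕ} (hn : 2 ≤ n) :
    2 * n ^ 2 ∈ cyclicDistinguishableLengths 2 (2 * n) ∧
      2 * n ^ 2 + 1 ∈ distinguishableLengths 2 (2 * n) := by
  have : NeZero (2 * n) := ⟨by omega⟩
  rw [← card_pairLoopTour]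
  refine mem_lengths_of_isClosedTour_nat (m := 1) (isClosedTour_pairLoopTour hn)
    (fun e he => length_of_mem_pairLoopTour he) ?_
    ((Finset.range n).image fun i => ({2 * i, 2 * i + 1} : Multiset ℕ)) ?_ exists_pairLoopTour_eq
  · rw [card_pairLoopTour]
    nlinarith
  · have h := two_mul_choose_add_one (2 * n)
    have hB : ((Finset.range n).image fun i => ({2 * i, 2 * i + 1} : Multiset ℕ)).card ≤ n :=
      Finset.card_image_le.trans (Finset.card_range n).le
    rw [card_pairLoopTour]
    simp only [Nat.reduceAdd]
    nlinarith

/-! ### Triples -/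

/-- The triples of letters in `{0, 1, 2}` other than `{0, 1, 2}` itself, as a closed walk. -/
def tripleWalk₁ : List (List ℕ) := wordWalk [0, 0] [0, 1, 1, 1, 2, 2, 2, 0, 0]

/-- The triples of letters that meet both `{0, 1, 2}` and `{3, 4, 5}`, as a closed walk. -/
def tripleWalk₂ : List (List ℕ) :=
  wordWalk [0, 0] [4, 4, 2, 5, 3, 1, 0, 5, 2, 1, 4, 5, 0, 5, 0, 3, 4, 2, 2, 5, 5, 1, 1, 3, 2, 3, 2,
    0, 4, 1, 4, 1, 3, 3, 0, 0]

/-- The triples of letters that meet `{0, 1, 2}`, `{3, 4, 5}` and `{6, 7, 8}`, as three closed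
walks. -/
def tripleWalk₃ : Fin 3 → List (List ℕ) :=
  ![wordWalk [0, 3] [6, 1, 4, 7, 2, 5, 8, 0, 3], wordWalk [0, 4] [8, 1, 5, 6, 2, 3, 7, 0, 4],
    wordWalk [0, 5] [7, 1, 3, 8, 2, 4, 6, 0, 5]]

theorem exists_mem_tripleWalk₁ : ∀ a b c : Fin 3, a ≤ b → b ≤ c → ¬ (a = 0 ∧ b = 1 ∧ c = 2) →
    ∃ e ∈ tripleWalk₁, (e : Multiset ℕ) = {a.val, b.val, c.val} := by
  decide

set_option maxRecDepth 10000 in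
theorem exists_mem_tripleWalk₂_left : ∀ a b c : Fin 3,
    ∃ e ∈ tripleWalk₂, (e : Multiset ℕ) = {a.val, b.val, 3 + c.val} := by
  decide

set_option maxRecDepth 10000 in
theorem exists_mem_tripleWalk₂_right : ∀ a b c : Fin 3,
    ∃ e ∈ tripleWalk₂, (e : Multiset ℕ) = {a.val, 3 + b.val, 3 + c.val} := by
  decide

set_option maxRecDepth 10000 in
theorem exists_mem_tripleWalk₃ : ∀ a b c : Fin 3,
    ∃ d, ∃ e ∈ tripleWalk₃ d, (e : Multiset ℕ) = {a.val, 3 + b.val, 6 + c.val} := by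
  decide

/-- Sends the letter `3 * t + a` (`a < 3`) to the letter `3 * c t + a`. -/
def relabel (c : ℕ → ℕ) (x : ℕ) : ℕ := 3 * c (x / 3) + x % 3

/-- The classes `i`, `j`, `l`, `l`, `l`, ... -/
def classes (i j l : ℕ) : ℕ → ℕ
  | 0 => i
  | 1 => j
  | _ => l

/-- The triples inside the class `i`. -/
def tripleTour₁ (i : ℕ) : Multiset (List ℕ) :=
  (tripleWalk₁ : Multiset (List ℕ)).map (List.map (relabel (classes i i i)))

/-- The triples in exactly the classes `i` and `j`. -/
def tripleTour₂ (i j : ℕ) : Multiset (List ℕ) :=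
  (tripleWalk₂ : Multiset (List ℕ)).map (List.map (relabel (classes i j j)))

/-- The triples in exactly the classes `i`, `j` and `l`. -/
def tripleTour₃ (i j l : ℕ) (d : Fin 3) : Multiset (List ℕ) :=
  (tripleWalk₃ d : Multiset (List ℕ)).map (List.map (relabel (classes i j l)))

/-- All triples in the classes `i < n`, but the classes themselves. -/
def tripleTour (n : ℕ) : Multiset (List ℕ) :=
  ∑ l ∈ Finset.range n, (tripleTour₁ l + ∑ j ∈ Finset.range l, (tripleTour₂ j l +
    ∑ i ∈ Finset.range j, ∑ d, tripleTour₃ i j l d))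

theorem isClosedTour_tripleTour₁ (i : ℕ) : IsClosedTour (tripleTour₁ i) :=
  (isClosedTour_wordWalk rfl : IsClosedTour (tripleWalk₁ : Multiset (List ℕ))).map _

theorem isClosedTour_tripleTour₂ (i j : ℕ) : IsClosedTour (tripleTour₂ i j) :=
  (isClosedTour_wordWalk rfl : IsClosedTour (tripleWalk₂ : Multiset (List ℕ))).map _

theorem isClosedTour_tripleTour₃ (i j l : ℕ) (d : Fin 3) : IsClosedTour (tripleTour₃ i j l d) := by
  refine IsClosedTour.map _ ?_
  fin_cases d <;> exact isClosedTour_wordWalk rfl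

theorem mem_tripleTour₁ {i n : ℕ} (hi : i < n) {e : List ℕ} (he : e ∈ tripleTour₁ i) :
    e ∈ tripleTour n :=
  Multiset.mem_sum.2 ⟨i, Finset.mem_range.2 hi, Multiset.mem_add.2 (Or.inl he)⟩

theorem mem_tripleTour₂ {i j n : ℕ} (hij : i < j) (hj : j < n) {e : List ℕ}
    (he : e ∈ tripleTour₂ i j) : e ∈ tripleTour n :=
  Multiset.mem_sum.2 ⟨j, Finset.mem_range.2 hj, Multiset.mem_add.2 (Or.inr
    (Multiset.mem_sum.2 ⟨i, Finset.mem_range.2 hij, Multiset.mem_add.2 (Or.inl he)⟩))⟩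

theorem mem_tripleTour₃ {i j l n : ℕ} (hij : i < j) (hjl : j < l) (hl : l < n) {d : Fin 3}
    {e : List ℕ} (he : e ∈ tripleTour₃ i j l d) : e ∈ tripleTour n :=
  Multiset.mem_sum.2 ⟨l, Finset.mem_range.2 hl, Multiset.mem_add.2 (Or.inr
    (Multiset.mem_sum.2 ⟨j, Finset.mem_range.2 hjl, Multiset.mem_add.2 (Or.inr
      (Multiset.mem_sum.2 ⟨i, Finset.mem_range.2 hij, Multiset.mem_sum.2
        ⟨d, Finset.mem_univ d, he⟩⟩))⟩))⟩

theorem map_relabel_mem {L : List (List ℕ)} {e : List ℕ} (c : ℕ → ℕ) (he : e ∈ L) :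
    e.map (relabel c) ∈ (L : Multiset (List ℕ)).map (List.map (relabel c)) :=
  Multiset.mem_map_of_mem _ (Multiset.mem_coe.2 he)

/-- When class `n` is added, the walk on classes `j` and `n` attaches at the vertex `00` of class
`j`. The walk inside class `n` then attaches at the vertex written `33` in a two-class walk. The
three-class walks come last, at mixed vertices of the walks on two older classes. -/
theorem isClosedTour_tripleTour (n : ℕ) : IsClosedTour (tripleTour n) := by
  induction n with
  | zero => simpa [tripleTour] using IsClosedTour.zero
  | succ n ih =>
    rcases Nat.eq_zero_or_pos n with rfl | hn
    · simpa [tripleTour] using isClosedTour_tripleTour₁ 0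
    have hsum : tripleTour (n + 1) = tripleTour n + ∑ j ∈ Finset.range n, tripleTour₂ j n +
        tripleTour₁ n + ∑ x ∈ (Finset.range n).sigma Finset.range, ∑ d, tripleTour₃ x.2 x.1 n d := by
      rw [tripleTour, Finset.sum_range_succ, ← tripleTour, Finset.sum_add_distrib,
        Finset.sum_sigma]
      abel
    rw [hsum, Finset.sum_sigma']
    have h₁ := ih.add_sum (Finset.range n) (fun j => tripleTour₂ j n)
      (fun j _ => isClosedTour_tripleTour₂ j n) (fun j hj =>
        ⟨_, mem_tripleTour₁ (Finset.mem_range.1 hj) (map_relabel_mem _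
          (by decide : [0, 0, 0] ∈ tripleWalk₁)), _, map_relabel_mem _
          (by decide : [0, 0, 4] ∈ tripleWalk₂), rfl⟩)
    -- Any older class would serve; class `0` exists because `n` is positive.
    have h₂ := h₁.add (isClosedTour_tripleTour₁ n)
      (Multiset.mem_add.2 (Or.inr (Multiset.mem_sum.2 ⟨0, Finset.mem_range.2 hn,
        map_relabel_mem _ (by decide : [3, 3, 0] ∈ tripleWalk₂)⟩)))
      (map_relabel_mem _ (by decide : [0, 0, 0] ∈ tripleWalk₁)) rfl
    refine h₂.add_sum _ _ (fun x _ => isClosedTour_tripleTour₃ _ _ _ _) ?_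
    rintro ⟨⟨j, i⟩, d⟩ hx
    have hj : j < n := by simp at hx; omega
    have hij : i < j := by simp at hx; omega
    obtain ⟨e, he, f, hf, hef⟩ : ∃ e ∈ tripleTour₂ i j, ∃ f ∈ tripleTour₃ i j n d,
        e.dropLast = f.dropLast := by
      -- The three walks start at `03`, `04` and `05`, all of them vertices of `tripleWalk₂`.
      fin_cases d
      · exact ⟨_, map_relabel_mem _ (by decide : [0, 3, 4] ∈ tripleWalk₂), _, map_relabel_mem _
          (by decide : [0, 3, 6] ∈ tripleWalk₃ 0), rfl⟩
      · exact ⟨_, map_relabel_mem _ (by decide : [0, 4, 1] ∈ tripleWalk₂), _, map_relabel_mem _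
          (by decide : [0, 4, 8] ∈ tripleWalk₃ 1), rfl⟩
      · exact ⟨_, map_relabel_mem _ (by decide : [0, 5, 2] ∈ tripleWalk₂), _, map_relabel_mem _
          (by decide : [0, 5, 7] ∈ tripleWalk₃ 2), rfl⟩
    exact ⟨e, Multiset.mem_add.2 (Or.inl (Multiset.mem_add.2 (Or.inl (mem_tripleTour₂ hij hj he)))),
      f, hf, hef⟩

theorem length_of_mem_tripleTour {n : ℕ} {e : List ℕ} (he : e ∈ tripleTour n) : e.length = 3 := by
  obtain ⟨l, -, he⟩ := Multiset.mem_sum.1 he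
  rcases Multiset.mem_add.1 he with he | he
  · obtain ⟨e', he', rfl⟩ := Multiset.mem_map.1 he
    rw [List.length_map]
    exact length_of_mem_wordWalk he'
  obtain ⟨j, -, he⟩ := Multiset.mem_sum.1 he
  rcases Multiset.mem_add.1 he with he | he
  · obtain ⟨e', he', rfl⟩ := Multiset.mem_map.1 he
    rw [List.length_map]
    exact length_of_mem_wordWalk he'
  obtain ⟨i, -, he⟩ := Multiset.mem_sum.1 he
  obtain ⟨d, -, he⟩ := Multiset.mem_sum.1 he
  obtain ⟨e', he', rfl⟩ := Multiset.mem_map.1 he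
  rw [List.length_map]
  fin_cases d <;> exact length_of_mem_wordWalk he'

theorem two_mul_card_tripleTour (n : ℕ) : 2 * (tripleTour n).card = 9 * n ^ 3 + 9 * n ^ 2 := by
  have h₁ : ∀ i, (tripleTour₁ i).card = 9 := fun i => Multiset.card_map _ _
  have h₂ : ∀ i j, (tripleTour₂ i j).card = 36 := fun i j => Multiset.card_map _ _
  have h₃ : ∀ i j l d, (tripleTour₃ i j l d).card = 9 := by
    intro i j l d
    rw [tripleTour₃, Multiset.card_map]
    fin_cases d <;> rfl
  have hsum : ∀ l : ℕ, 2 * ∑ j ∈ Finset.range l, (36 + 27 * j) = 27 * l ^ 2 + 45 * l := by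
    intro l
    induction l with
    | zero => rfl
    | succ l ih => rw [Finset.sum_range_succ, mul_add, ih]; ring
  induction n with
  | zero => rfl
  | succ n ih =>
    have hn := hsum n
    rw [tripleTour, Finset.sum_range_succ, ← tripleTour]
    simp only [Multiset.card_add, Multiset.card_sum, h₁, h₂, h₃, Finset.sum_const, Finset.card_range,
      Finset.card_univ, Fintype.card_fin, smul_eq_mul]
    have : ∀ j, j * (3 * 9) = 27 * j := fun j => by ring
    simp only [this]
    linarith

theorem relabel_add (c : ℕ → ℕ) (t : ℕ) (a : Fin 3) : relabel c (3 * t + a) = 3 * c t + a := by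
  have := a.isLt
  rw [relabel, show (3 * t + a.val) / 3 = t by omega, show (3 * t + a.val) % 3 = a by omega]

theorem coe_map_relabel {e : List ℕ} {t u v : ℕ} {a b d : Fin 3} (c : ℕ → ℕ)
    (he : (e : Multiset ℕ) = {3 * t + a.val, 3 * u + b.val, 3 * v + d.val}) :
    (e.map (relabel c) : Multiset ℕ) =
      {3 * c t + a.val, 3 * c u + b.val, 3 * c v + d.val} := by
  rw [← Multiset.map_coe, he]
  simp [relabel_add]

theorem exists_tripleTour_eq {n : ℕ} (σ : Multiset ℕ) (hσ : σ.card = 3)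
    (hn : ∀ x ∈ σ, x < 3 * n)
    (hB : σ ∉ (Finset.range n).image fun i => ({3 * i, 3 * i + 1, 3 * i + 2} : Multiset ℕ)) :
    ∃ e ∈ tripleTour n, (e : Multiset ℕ) = σ := by
  -- Sorting the letters also sorts their classes, which leaves four cases: each of `i ≤ j` and `j ≤
  -- l` is an equality or strict.
  obtain ⟨p, q, r, hpq, hqr, rfl⟩ : ∃ p q r, p ≤ q ∧ q ≤ r ∧ σ = {p, q, r} := by
    have hs := Multiset.pairwise_sort σ (· ≤ ·)
    have hl : (σ.sort (· ≤ ·)).length = 3 := by rw [Multiset.length_sort, hσ]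
    obtain ⟨p, q, r, h⟩ := List.length_eq_three.1 hl
    rw [h] at hs
    simp at hs
    refine ⟨p, q, r, hs.1.1, hs.2, ?_⟩
    rw [← Multiset.sort_eq σ (· ≤ ·), h]
    rfl
  have hr : r < 3 * n := hn r (by simp)
  have hdiv : ∀ x : ℕ, ∃ (t : ℕ) (a : Fin 3), x = 3 * t + a.val := fun x =>
    ⟨x / 3, ⟨x % 3, Nat.mod_lt _ (by norm_num)⟩, (Nat.div_add_mod x 3).symm⟩
  obtain ⟨i, a, rfl⟩ := hdiv p
  obtain ⟨j, b, rfl⟩ := hdiv q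
  obtain ⟨l, c, rfl⟩ := hdiv r
  have hln : l < n := by omega
  have hij : i ≤ j := by omega
  have hjl : j ≤ l := by omega
  rcases hij.eq_or_lt with rfl | hij <;> rcases hjl.eq_or_lt with rfl | hjl
  · obtain ⟨e, he, heq⟩ := exists_mem_tripleWalk₁ a b c (by rw [Fin.le_def]; omega)
      (by rw [Fin.le_def]; omega) (by
        rintro ⟨rfl, rfl, rfl⟩
        exact hB (Finset.mem_image.2 ⟨i, Finset.mem_range.2 hln, rfl⟩))
    exact ⟨_, mem_tripleTour₁ hln (map_relabel_mem _ he),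
      coe_map_relabel (t := 0) (u := 0) (v := 0) (classes i i i) (by simpa using heq)⟩
  · obtain ⟨e, he, heq⟩ := exists_mem_tripleWalk₂_left a b c
    exact ⟨_, mem_tripleTour₂ hjl hln (map_relabel_mem _ he),
      coe_map_relabel (t := 0) (u := 0) (v := 1) (classes i l l) (by simpa using heq)⟩
  · obtain ⟨e, he, heq⟩ := exists_mem_tripleWalk₂_right a b c
    exact ⟨_, mem_tripleTour₂ hij hln (map_relabel_mem _ he),
      coe_map_relabel (t := 0) (u := 1) (v := 1) (classes i j j) (by simpa using heq)⟩
  · obtain ⟨d, e, he, heq⟩ := exists_mem_tripleWalk₃ a b c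
    exact ⟨_, mem_tripleTour₃ hij hjl hln (map_relabel_mem _ he),
      coe_map_relabel (t := 0) (u := 1) (v := 2) (classes i j l) (by simpa using heq)⟩

theorem triple_lengths {n : ℕ} (hn : 0 < n) :
    (3 * n + 2).choose 3 - n ∈ cyclicDistinguishableLengths 3 (3 * n) ∧
      (3 * n + 2).choose 3 - n + 2 ∈ distinguishableLengths 3 (3 * n) := by
  have : NeZero (3 * n) := ⟨by omega⟩
  have hcard : (tripleTour n).card + n = (3 * n + 2).choose 3 := by
    have h := two_mul_card_tripleTour n
    have h' := six_mul_choose_add_two (3 * n)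
    have : 3 * n * (3 * n + 1) * (3 * n + 2) = 3 * (9 * n ^ 3 + 9 * n ^ 2) + 6 * n := by ring
    omega
  rw [← hcard, Nat.add_sub_cancel]
  refine mem_lengths_of_isClosedTour_nat (m := 2) (isClosedTour_tripleTour n)
    (fun e he => length_of_mem_tripleTour he) ?_
    ((Finset.range n).image fun i => ({3 * i, 3 * i + 1, 3 * i + 2} : Multiset ℕ)) ?_
    exists_tripleTour_eq
  · have h := two_mul_card_tripleTour n
    have h₂ : 1 ≤ n ^ 2 := Nat.one_le_pow _ _ hn
    have h₃ : 1 ≤ n ^ 3 := Nat.one_le_pow _ _ hn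
    omega
  · change _ ≤ (3 * n + 2).choose 3
    rw [← hcard]
    exact Nat.add_le_add_left (Finset.card_image_le.trans (Finset.card_range n).le) _

/-! ### Non-divisibility and conclusion -/

/-- The total is `2 * n + 1`. -/
theorem not_two_dvd_totalMultiplicity {n : ℕ} (x : Fin (2 * n)) :
    ¬ 2 ∣ totalMultiplicity 2 (2 * n) x := by
  have hk : 0 < 2 * n := x.pos
  have h := mul_totalMultiplicity 2 (2 * n) x
  rw [show 2 * n + 2 - 1 = 2 * n + 1 from rfl, two_mul_choose_add_one] at h
  have := Nat.eq_of_mul_eq_mul_left hk h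
  omega

/-- Twice the total is `(3 * n + 1) * (3 * n + 2)`, which is `2` modulo `3`. -/
theorem not_three_dvd_totalMultiplicity {n : ℕ} (x : Fin (3 * n)) :
    ¬ 3 ∣ totalMultiplicity 3 (3 * n) x := by
  have hk : 0 < 3 * n := x.pos
  have h := mul_totalMultiplicity 3 (3 * n) x
  rw [Nat.add_sub_assoc (by norm_num : 1 ≤ 3)] at h
  have h' := six_mul_choose_add_two (3 * n)
  simp only [Nat.reduceSub] at h
  have h₂ : 2 * totalMultiplicity 3 (3 * n) x = (3 * n + 1) * (3 * n + 2) := by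
    refine Nat.eq_of_mul_eq_mul_left hk ?_
    calc _ = 2 * (3 * n * totalMultiplicity 3 (3 * n) x) := by ring
      _ = 6 * (3 * n + 2).choose 3 := by rw [h]; ring
      _ = _ := by rw [h']; ring
  have h₃ : (3 * n + 1) * (3 * n + 2) = 3 * (3 * n ^ 2 + 3 * n) + 2 := by ring
  omega

theorem isGreatest_maxLength {m k M : ℕ} (hM : M ∈ distinguishableLengths m k) :
    IsGreatest (distinguishableLengths m k) (maxLength m k) ∧ maxLength m k ≥ M := by
  have h : IsGreatest (distinguishableLengths m k) (maxLength m k) :=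
    isGreatest_sSup_nat ⟨M, hM⟩ fun _ hn => le_of_mem_distinguishableLengths hn
  exact ⟨h, h.2 hM⟩

theorem isGreatest_maxCyclicLength {m k M : ℕ} (hM : M ∈ cyclicDistinguishableLengths m k)
    (hub : ∀ N ∈ cyclicDistinguishableLengths m k, N ≤ M) :
    IsGreatest (cyclicDistinguishableLengths m k) (maxCyclicLength m k) ∧
      maxCyclicLength m k = M := by
  have h : IsGreatest (cyclicDistinguishableLengths m k) (maxCyclicLength m k) :=
    isGreatest_sSup_nat ⟨M, hM⟩ hub
  exact ⟨h, le_antisymm (hub _ h.1) (h.2 hM)⟩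

/-- With a single class the loops `00` and `11` share no vertex and no closed tour contains both;
the linear sequence `001` does instead. -/
theorem three_mem_distinguishableLengths_two_two : 3 ∈ distinguishableLengths 2 2 :=
  mem_distinguishableLengths_of_trail (m := 1) (v := [(0 : Fin 2)])
    (wordTrail_wordWalk [0] [0, 1]) (fun _ he => length_of_mem_wordWalk he) rfl
    (by decide) (by decide)

theorem mainTheorem4 :
    (∀ k : ℕ, 4 ≤ k → Even k →
      IsGreatest (cyclicDistinguishableLengths 2 k) (maxCyclicLength 2 k) ∧
      maxCyclicLength 2 k = (k + 1).choose 2 - k / 2) ∧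
    (∀ k : ℕ, 2 ≤ k → Even k →
      IsGreatest (distinguishableLengths 2 k) (maxLength 2 k) ∧
      maxLength 2 k ≥ (k + 1).choose 2 - k / 2 + 1) ∧
    (∀ k : ℕ, 0 < k → 3 ∣ k →
      (IsGreatest (cyclicDistinguishableLengths 3 k) (maxCyclicLength 3 k) ∧
        maxCyclicLength 3 k = (k + 2).choose 3 - k / 3) ∧
      (IsGreatest (distinguishableLengths 3 k) (maxLength 3 k) ∧
        maxLength 3 k ≥ (k + 2).choose 3 - k / 3 + 2)) := by
  have hpair : ∀ n : ℕ, (2 * n + 1).choose 2 - 2 * n / 2 = 2 * n ^ 2 := by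
    intro n
    have h := two_mul_choose_add_one (2 * n)
    have h' : 2 * n * (2 * n + 1) = 2 * (2 * n ^ 2) + 2 * n := by ring
    omega
  refine ⟨?_, ?_, ?_⟩
  · intro k hk hek
    obtain ⟨n, rfl⟩ := hek.two_dvd
    refine isGreatest_maxCyclicLength (by rw [hpair]; exact (pair_lengths (by omega)).1)
      fun N hN => ?_
    have := add_le_choose_of_mem_cyclicDistinguishableLengths not_two_dvd_totalMultiplicity hN
    rw [Nat.add_sub_assoc one_le_two] at this
    exact Nat.le_sub_of_add_le this
  · intro k hk hek
    obtain ⟨n, rfl⟩ := hek.two_dvd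
    refine isGreatest_maxLength ?_
    rw [hpair]
    rcases (by omega : n = 1 ∨ 2 ≤ n) with rfl | hn
    · exact three_mem_distinguishableLengths_two_two
    · exact (pair_lengths hn).2
  · rintro k hk ⟨n, rfl⟩
    have hdiv : 3 * n / 3 = n := by omega
    have h := triple_lengths (by omega : 0 < n)
    rw [← hdiv] at h
    simp only [hdiv] at h ⊢
    refine ⟨isGreatest_maxCyclicLength h.1 fun N hN => ?_, isGreatest_maxLength h.2⟩
    have := add_le_choose_of_mem_cyclicDistinguishableLengths not_three_dvd_totalMultiplicity hN
    rw [Nat.add_sub_assoc (by norm_num : 1 ≤ 3), hdiv] at this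
    exact Nat.le_sub_of_add_le this
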